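/- Let $N\ge 3$ be an integer, $2^*=\frac{2N}{N-2}$ and $p>2^*-1=\frac{N+2}{N-2}$. Let $u:\mathbb{R}^N\to\mathbb{R}$ be a radial ground state, that is, a radially symmetric classical solution, with $|\nabla u|<1$ everywhere, of $$\nabla\cdot\left[\frac{\nabla u}{\sqrt{1-|\nabla u|^2}}\right]+u^p=0\quad\text{in }\mathbb{R}^N,\qquad u>0\ \text{ in }\mathbb{R}^N,\qquad u(x)\to0\ \text{ as }|x|\to\infty .$$ Let $D^{1,2}(\mathbb{R}^N)$ be the space of the functions in $L^{2^*}(\mathbb{R}^N)$ whose weak gradient is in $L^2(\mathbb{R}^N)$ (equivalently, the completion of $C_c^\infty(\mathbb{R}^N)$ in the norm $\|\nabla\varphi\|_{L^2}$). Then one of the following holds: (1) $u\in D^{1,2}(\mathbb{R}^N)$ and $u(x)=O\big(|x|^{-(N-2)}\big)$ as $|x|\to\infty$; (2) $u\notin D^{1,2}(\mathbb{R}^N)$, and there are constants $c_1,c_2>0$ such that, for all $x$ with $|x|$ large enough, $$c_1|x|^{-\frac{2N}{(N-1)(p+1)-2N}}\le u(x)\le c_2|x|^{-\frac{2}{p-1}};$$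 moreover, there is no $\alpha>\frac{2}{p-1}$ for which some $c>0$ satisfies $u(x)\le c|x|^{-\alpha}$ for all $x$ with $|x|$ large enough. -/

import Mathlib

open MeasureTheory Filter Topology Asymptotics
open scoped ContDiff Gradient

namespace LorentzMinkowski

/-- The divergence `∑ i, ∂ᵢ Xᵢ` of a vector field on `ℝᴺ`. -/
noncomputable def divergence {N : ℕ}
    (X : EuclideanSpace ℝ (Fin N) → EuclideanSpace ℝ (Fin N))
    (x : EuclideanSpace ℝ (Fin N)) : ℝ :=
  ∑ i : Fin N, (fderiv ℝ X x (EuclideanSpace.single i 1)) i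

/-- The vector field `∇u / √(1 - |∇u|²)`. -/
noncomputable def flux {N : ℕ} (u : EuclideanSpace ℝ (Fin N) → ℝ)
    (x : EuclideanSpace ℝ (Fin N)) : EuclideanSpace ℝ (Fin N) :=
  (1 / Real.sqrt (1 - ‖∇ u x‖ ^ 2)) • ∇ u x

/-- Ground states: classical solutions of `div (∇u / √(1 - |∇u|²)) + u ^ p = 0` in `ℝᴺ` that are
positive and vanish at infinity. The condition `|∇u| < 1` is what gives the equation a meaning.
Every `C²` function with `|∇u| < 1` satisfies the first and the third field. -/
structure IsGroundState {N : ℕ} (p : ℝ) (u : EuclideanSpace ℝ (Fin N) → ℝ) : Prop where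
  differentiable : Differentiable ℝ u
  norm_gradient_lt_one : ∀ x, ‖∇ u x‖ < 1
  differentiable_flux : Differentiable ℝ (flux u)
  equation : ∀ x, divergence (flux u) x + u x ^ p = 0
  pos : ∀ x, 0 < u x
  vanishes : Tendsto u (cocompact (EuclideanSpace ℝ (Fin N))) (𝓝 0)

/-- Radial functions: `u x` depends only on `|x|`. -/
def IsRadial {N : ℕ} (u : EuclideanSpace ℝ (Fin N) → ℝ) : Prop :=
  ∀ x y, ‖x‖ = ‖y‖ → u x = u y

/-- `g` is the weak (distributional) gradient of `u` on `ℝᴺ`. -/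
def IsWeakGradient {N : ℕ} (u : EuclideanSpace ℝ (Fin N) → ℝ)
    (g : EuclideanSpace ℝ (Fin N) → EuclideanSpace ℝ (Fin N)) : Prop :=
  LocallyIntegrable u volume ∧ LocallyIntegrable g volume ∧
    ∀ φ : EuclideanSpace ℝ (Fin N) → ℝ, ContDiff ℝ ∞ φ → HasCompactSupport φ →
      ∀ i : Fin N, ∫ x, u x * fderiv ℝ φ x (EuclideanSpace.single i 1) = -∫ x, g x i * φ x

/-- The space `D^{1,2}(ℝᴺ)`, `N ≥ 3`: functions in `L^{2*}(ℝᴺ)`, `2* = 2N/(N-2)`, with weak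
gradient in `L²(ℝᴺ)`. -/
def MemD12 {N : ℕ} (u : EuclideanSpace ℝ (Fin N) → ℝ) : Prop :=
  MemLp u (ENNReal.ofReal (2 * (N : ℝ) / ((N : ℝ) - 2))) volume ∧
    ∃ g : EuclideanSpace ℝ (Fin N) → EuclideanSpace ℝ (Fin N),
      IsWeakGradient u g ∧ MemLp g 2 volume

end LorentzMinkowski

namespace LorentzMinkowski

/-! Along a ray, `u` becomes a profile `v` with flux `f`: `v' = -f / √(1 + f ^ 2)` and `(r ^ (d - 1)
* f)' = r ^ (d - 1) * v ^ p`, with `d = N`. Thus `f ≥ 0`, `v` is nonincreasing, and the dissipated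
energy bounds `f`, which gives the decay exponent `m = 2 / (p - 1)` (`powerDecay_base`). The
alternative is whether `v` decays with some exponent `α > m`.

If it does, integrating the system twice turns the exponent `α` into `α * p - 2`. This map fixes `m`
and expands distances to `m`, so finitely many rounds reach `f = O(r ^ (1 - d))` and `v = O(r ^ (2 -
d))` (`powerDecay_flux`, `powerDecay_profile`); these rates give membership in `D^{1,2}`.

If it does not, `u` is not even in `L^{2*}`: a nonincreasing profile in that space decays with
exponent `(N - 2) / 2`, which exceeds `m` because `p` is supercritical (`powerDecay_of_memLp`). For
the lower bound, the Pohozaev functional is eventually nonincreasing. If it stayed nonnegative, the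
integral of `r ^ (d - 1) * f ^ 2` would converge, forcing the same forbidden decay
(`pohozaev_neg_or_powerDecay`). So it becomes negative, which bounds the energy `E` by a power of
`v`; then `-v'` is at most a power of `v`, and integration bounds `v` from below
(`exists_le_of_pohozaev_neg`). -/

theorem le_of_hasDerivAt_nonneg {g g' : ℝ → ℝ} {a b : ℝ} (hab : a ≤ b)
    (h : ∀ x ∈ Set.Icc a b, HasDerivAt g (g' x) x) (h0 : ∀ x ∈ Set.Icc a b, 0 ≤ g' x) :
    g a ≤ g b := by
  have hm : MonotoneOn g (Set.Icc a b) := by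
    refine monotoneOn_of_deriv_nonneg (convex_Icc a b)
      (fun x hx => (h x hx).continuousAt.continuousWithinAt)
      (fun x hx => (h x (interior_subset hx)).differentiableAt.differentiableWithinAt)
      (fun x hx => ?_)
    rw [(h x (interior_subset hx)).deriv]
    exact h0 x (interior_subset hx)
  exact hm ⟨le_rfl, hab⟩ ⟨hab, le_rfl⟩ hab

theorem mul_sub_le_of_le_hasDerivAt {g g' : ℝ → ℝ} {a b C : ℝ} (hab : a ≤ b)
    (h : ∀ x ∈ Set.Icc a b, HasDerivAt g (g' x) x) (h0 : ∀ x ∈ Set.Icc a b, C ≤ g' x) :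
    C * (b - a) ≤ g b - g a := by
  have := le_of_hasDerivAt_nonneg (g := fun x => g x - C * x) (g' := fun x => g' x - C * 1) hab
    (fun x hx => (h x hx).sub ((hasDerivAt_id x).const_mul C))
    (fun x hx => by linarith [h0 x hx])
  linarith

/-- `g r = O(r ^ (-α))` from above, as `r → ∞`. -/
def PowerDecay (g : ℝ → ℝ) (α : ℝ) : Prop :=
  ∃ C R : ℝ, 0 < C ∧ 0 < R ∧ ∀ r, R ≤ r → g r ≤ C * r ^ (-α)

/-- The radial equation written as a first order system for the profile `v` and the
flux `f = -v' / √(1 - v' ^ 2)`, in dimension `d`. -/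
structure IsRadialProfile (d p : ℝ) (v f : ℝ → ℝ) : Prop where
  hasDerivAt_profile : ∀ r, 0 < r → HasDerivAt v (-(f r / √(1 + f r ^ 2))) r
  hasDerivAt_flux : ∀ r, 0 < r → HasDerivAt f (v r ^ p - (d - 1) * f r / r) r
  pos : ∀ r, 0 < r → 0 < v r
  tendsto_zero : Tendsto v atTop (𝓝 0)
  bounded : ∃ B : ℝ, ∀ r, 0 < r → r ≤ 1 → |f r| ≤ B

theorem one_le_sqrt_one_add_sq (t : ℝ) : 1 ≤ √(1 + t ^ 2) :=
  Real.one_le_sqrt.2 (by nlinarith [sq_nonneg t])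

theorem sq_sqrt_one_add_sq (t : ℝ) : √(1 + t ^ 2) ^ 2 = 1 + t ^ 2 :=
  Real.sq_sqrt (by positivity)

/-! ### Monotonicity, energy and base decay for the radial system. -/

namespace IsRadialProfile

variable {d p : ℝ} {v f : ℝ → ℝ}

theorem hasDerivAt_mass (h : IsRadialProfile d p v f) {r : ℝ} (hr : 0 < r) :
    HasDerivAt (fun s => s ^ (d - 1) * f s) (r ^ (d - 1) * v r ^ p) r := by
  have h1 := (Real.hasDerivAt_rpow_const (x := r) (p := d - 1) (Or.inl hr.ne')).mul
    (h.hasDerivAt_flux r hr)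
  refine h1.congr_deriv ?_
  rw [Real.rpow_sub_one hr.ne' (d - 1)]
  field_simp
  ring

theorem mass_le (h : IsRadialProfile d p v f) {r s : ℝ} (hr : 0 < r) (hrs : r ≤ s) :
    r ^ (d - 1) * f r ≤ s ^ (d - 1) * f s := by
  refine le_of_hasDerivAt_nonneg (g := fun s => s ^ (d - 1) * f s) hrs
    (fun x hx => h.hasDerivAt_mass (hr.trans_le hx.1)) (fun x hx => ?_)
  have hx0 := hr.trans_le hx.1
  have := h.pos x hx0
  positivity

/-- Boundedness of `f` near the origin stands in for regularity there: it bounds `s ^ (d - 1) * f s`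
below by a quantity tending to `0` as `s → 0`, and this mass is nondecreasing. -/
theorem flux_nonneg (h : IsRadialProfile d p v f) (hd : 2 < d) {r : ℝ} (hr : 0 < r) :
    0 ≤ f r := by
  obtain ⟨B, hB⟩ := h.bounded
  have hlim : Tendsto (fun s : ℝ => s ^ (d - 1) * -B) (𝓝[>] 0) (𝓝 0) := by
    have : ContinuousAt (fun s : ℝ => s ^ (d - 1) * -B) 0 :=
      (Real.continuousAt_rpow_const _ _ (Or.inr (by linarith))).mul continuousAt_const
    have h2 := this.tendsto
    rw [Real.zero_rpow (by linarith), zero_mul] at h2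
    exact h2.mono_left nhdsWithin_le_nhds
  have h0 : 0 ≤ r ^ (d - 1) * f r := by
    refine le_of_tendsto hlim ?_
    have hmem : Set.Ioo 0 (min r 1) ∈ 𝓝[>] (0 : ℝ) := Ioo_mem_nhdsGT (lt_min hr one_pos)
    filter_upwards [hmem] with s hs
    refine le_trans ?_ (h.mass_le hs.1 (hs.2.le.trans (min_le_left _ _)))
    have := hB s hs.1 (hs.2.le.trans (min_le_right _ _))
    have h3 := (abs_le.1 this).1
    have := Real.rpow_nonneg hs.1.le (d - 1)
    gcongr
  exact nonneg_of_mul_nonneg_right h0 (Real.rpow_pos_of_pos hr _)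

theorem antitone (h : IsRadialProfile d p v f) (hd : 2 < d) {r s : ℝ} (hr : 0 < r)
    (hrs : r ≤ s) : v s ≤ v r := by
  have := le_of_hasDerivAt_nonneg (g := fun x => - v x) hrs
    (fun x hx => (h.hasDerivAt_profile x (hr.trans_le hx.1)).neg) (fun x hx => by
      have := h.flux_nonneg hd (hr.trans_le hx.1)
      rw [neg_neg]; positivity)
  simpa using this

/-- The energy `√(1 + f ^ 2) - 1 + v ^ (p + 1) / (p + 1)`. -/
noncomputable def energy (p : ℝ) (v f : ℝ → ℝ) (r : ℝ) : ℝ :=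
  √(1 + f r ^ 2) - 1 + v r ^ (p + 1) / (p + 1)

theorem hasDerivAt_energy (h : IsRadialProfile d p v f) (hp : 1 < p) {r : ℝ} (hr : 0 < r) :
    HasDerivAt (energy p v f) (-((d - 1) * f r ^ 2 / (r * √(1 + f r ^ 2)))) r := by
  have hv := h.pos r hr
  have h1 := (((h.hasDerivAt_flux r hr).pow 2).const_add 1).sqrt
    (by positivity : 1 + f r ^ 2 ≠ 0)
  have h2 := ((h.hasDerivAt_profile r hr).rpow_const (p := p + 1) (Or.inl hv.ne')).div_const (p + 1)
  have h3 := (h1.sub_const 1).add h2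
  refine h3.congr_deriv ?_
  have hq : √(1 + f r ^ 2) ≠ 0 := by positivity
  have hp1 : p + 1 ≠ 0 := by linarith
  rw [add_sub_cancel_right]
  simp only [Nat.cast_ofNat, Pi.pow_apply]
  field_simp
  ring

theorem energy_antitone (h : IsRadialProfile d p v f) (hd : 2 < d) (hp : 1 < p) {r s : ℝ}
    (hr : 0 < r) (hrs : r ≤ s) : energy p v f s ≤ energy p v f r := by
  have := le_of_hasDerivAt_nonneg (g := fun x => - energy p v f x) hrs
    (fun x hx => (h.hasDerivAt_energy hp (hr.trans_le hx.1)).neg) (fun x hx => by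
      have h0 := hr.trans_le hx.1
      have : 0 < d - 1 := by linarith
      rw [neg_neg]; positivity)
  simpa using this

theorem sqrt_sub_one_le_energy (h : IsRadialProfile d p v f) (hp : 1 < p) {r : ℝ} (hr : 0 < r) :
    √(1 + f r ^ 2) - 1 ≤ energy p v f r := by
  have hv := h.pos r hr
  have : 0 ≤ v r ^ (p + 1) / (p + 1) := by positivity
  simp only [energy]; linarith

/-- The energy decreases, so it controls `f` away from the origin. Hence `-v'` and `f` are
comparable there, with constants `1 / Q` and `1`. -/
theorem exists_sqrt_le (h : IsRadialProfile d p v f) (hd : 2 < d) (hp : 1 < p) :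
    ∃ Q : ℝ, 1 ≤ Q ∧ ∀ r, 1 ≤ r → √(1 + f r ^ 2) ≤ Q := by
  have key : ∀ r, 1 ≤ r → √(1 + f r ^ 2) ≤ energy p v f 1 + 1 := fun r hr => by
    linarith [h.sqrt_sub_one_le_energy hp (one_pos.trans_le hr),
      h.energy_antitone hd hp one_pos hr]
  exact ⟨_, (one_le_sqrt_one_add_sq _).trans (key 1 le_rfl), key⟩

/-- Integrate the mass derivative over `[r / 2, r]`, where `v ≥ v r` and the weight is at least `(r
/ 2) ^ (d - 1)`. -/
theorem mul_rpow_le_flux (h : IsRadialProfile d p v f) (hd : 2 < d) (hp : 1 < p) {r : ℝ}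
    (hr : 0 < r) : (1 / 2) ^ d * (r * v r ^ p) ≤ f r := by
  have hv := h.pos r hr
  have h2 : 0 < r / 2 := by positivity
  have := mul_sub_le_of_le_hasDerivAt (g := fun s => s ^ (d - 1) * f s)
    (C := (r / 2) ^ (d - 1) * v r ^ p) (by linarith : r / 2 ≤ r)
    (fun x hx => h.hasDerivAt_mass (h2.trans_le hx.1)) (fun x hx => by
      have hx0 := h2.trans_le hx.1
      have h3 := h.antitone hd hx0 hx.2
      have : (r / 2) ^ (d - 1) ≤ x ^ (d - 1) :=
        Real.rpow_le_rpow h2.le hx.1 (by linarith)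
      gcongr)
  have h4 : 0 ≤ (r / 2) ^ (d - 1) * f (r / 2) :=
    mul_nonneg (by positivity) (h.flux_nonneg hd h2)
  have h5 : (r / 2) ^ (d - 1) = r ^ (d - 1) * ((1 / 2) ^ d * 2) := by
    rw [div_eq_mul_one_div, Real.mul_rpow hr.le (by norm_num),
      Real.rpow_sub_one (x := 1 / 2) (by norm_num)]
    ring
  simp only [h5] at this h4
  have h6 : 0 < r ^ (d - 1) := by positivity
  refine le_of_mul_le_mul_left ?_ h6
  calc _ = r ^ (d - 1) * ((1 / 2) ^ d * 2) * v r ^ p * (r - r / 2) := by ring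
    _ ≤ _ := by linarith

/-- Every profile decays at least like `r ^ (-2 / (p - 1))`. -/
theorem powerDecay_base (h : IsRadialProfile d p v f) (hd : 2 < d) (hp : 1 < p) :
    PowerDecay v (2 / (p - 1)) := by
  obtain ⟨Q, hQ1, hQ⟩ := h.exists_sqrt_le hd hp
  have hp0 : 0 < p - 1 := by linarith
  set c : ℝ := (p - 1) * (1 / 2) ^ d / Q with hc
  have hc0 : 0 < c := by positivity
  -- The flux bound makes `(v ^ (-(p - 1)))' ≥ c * x`. On `[r / 2, r]` this is at least `c * r / 2`,
  -- whence `c / 4`; `r ≥ 2` keeps the interval in the range where `Q` applies.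
  have key : ∀ r, 2 ≤ r → c / 4 * r ^ 2 ≤ v r ^ (-(p - 1)) := fun r hr => by
    have h2 : 0 < r / 2 := by linarith
    have h3 := mul_sub_le_of_le_hasDerivAt (g := fun s => v s ^ (-(p - 1))) (C := c * (r / 2))
      (by linarith : r / 2 ≤ r)
      (fun x hx => (h.hasDerivAt_profile x (h2.trans_le hx.1)).rpow_const
        (Or.inl (h.pos x (h2.trans_le hx.1)).ne')) (fun x hx => by
        have hx0 := h2.trans_le hx.1
        have hv := h.pos x hx0
        have h4 := h.mul_rpow_le_flux hd hp hx0
        have h5 := hQ x (by linarith [hx.1])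
        have h7 : v x ^ (-(p - 1) - 1) = (v x ^ p)⁻¹ := by
          rw [← Real.rpow_neg hv.le]; congr 1; ring
        have h8 : 0 < v x ^ p := by positivity
        rw [h7]
        have h9 : (1 / 2) ^ d * (x * v x ^ p) / Q ≤ f x / √(1 + f x ^ 2) := by
          have := h.flux_nonneg hd hx0
          gcongr
        calc c * (r / 2) ≤ c * x := by gcongr; exact hx.1
          _ = (p - 1) * ((1 / 2) ^ d * (x * v x ^ p) / Q) * (v x ^ p)⁻¹ := by
              rw [hc]; field_simp
          _ ≤ (p - 1) * (f x / √(1 + f x ^ 2)) * (v x ^ p)⁻¹ := by gcongr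
          _ = _ := by ring)
    have h10 : 0 ≤ v (r / 2) ^ (-(p - 1)) := Real.rpow_nonneg (h.pos _ h2).le _
    nlinarith
  refine ⟨(c / 4) ^ (-(1 / (p - 1))), 2, by positivity, by norm_num, fun r hr => ?_⟩
  have hr0 : 0 < r := by linarith
  have hv := h.pos r hr0
  have h1 := Real.rpow_le_rpow_of_nonpos (by positivity) (key r hr)
    (by rw [neg_nonpos]; positivity : -(1 / (p - 1)) ≤ 0)
  rw [← Real.rpow_mul hv.le, Real.mul_rpow (by positivity) (by positivity),
    ← Real.rpow_natCast, ← Real.rpow_mul hr0.le] at h1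
  have e1 : -(p - 1) * -(1 / (p - 1)) = 1 := by field_simp
  have e2 : ((2 : ℕ) : ℝ) * -(1 / (p - 1)) = -(2 / (p - 1)) := by push_cast; ring
  rwa [e1, e2, Real.rpow_one] at h1

/-! ### Transfer of decay between profile and flux, and the bootstrap. -/

theorem le_div_sqrt_of_nonneg {t : ℝ} (ht : 0 ≤ t) : t / √(1 + t ^ 2) ≤ t :=
  div_le_self ht (one_le_sqrt_one_add_sq t)

/-- Since `-v' ≤ f` and `v` vanishes at infinity, integrate the flux bound from `r` to infinity.
Here `γ` is the decay exponent of the source `v ^ p`; each integration costs one power. -/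
theorem powerDecay_profile_of_flux (h : IsRadialProfile d p v f) (hd : 2 < d) {γ : ℝ}
    (hγ : 2 < γ) (hf : PowerDecay f (γ - 1)) : PowerDecay v (γ - 2) := by
  obtain ⟨C, R, hC, hR, hf⟩ := hf
  have hγ0 : 0 < γ - 2 := by linarith
  refine ⟨C / (γ - 2), R, by positivity, hR, fun r hr => ?_⟩
  have hr0 := hR.trans_le hr
  have hmono : ∀ s, r ≤ s →
      v r - C / (γ - 2) * r ^ (-(γ - 2)) ≤ v s - C / (γ - 2) * s ^ (-(γ - 2)) := fun s hs => by
    refine le_of_hasDerivAt_nonneg (g := fun s => v s - C / (γ - 2) * s ^ (-(γ - 2))) hs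
      (fun x hx => (h.hasDerivAt_profile x (hr0.trans_le hx.1)).sub
        ((Real.hasDerivAt_rpow_const (Or.inl (hr0.trans_le hx.1).ne')).const_mul _))
      (fun x hx => ?_)
    have hx0 := hr0.trans_le hx.1
    have h1 := le_div_sqrt_of_nonneg (h.flux_nonneg hd hx0)
    have h2 := hf x (hr.trans hx.1)
    have e : C / (γ - 2) * (-(γ - 2) * x ^ (-(γ - 2) - 1)) = - (C * x ^ (-(γ - 1))) := by
      rw [show -(γ - 2) - 1 = -(γ - 1) by ring]; field_simp
    rw [e]; linarith
  have hlim : Tendsto (fun s => v s - C / (γ - 2) * s ^ (-(γ - 2))) atTop (𝓝 0) := by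
    simpa using h.tendsto_zero.sub ((tendsto_rpow_neg_atTop hγ0).const_mul (C / (γ - 2)))
  have := ge_of_tendsto hlim ((eventually_ge_atTop r).mono hmono)
  linarith

theorem rpow_le_of_powerDecay (h : IsRadialProfile d p v f) (hp : 1 < p) {C R α x : ℝ}
    (hC : 0 < C) (hx : 0 < x) (hv : ∀ r, R ≤ r → v r ≤ C * r ^ (-α)) (hRx : R ≤ x) :
    x ^ (d - 1) * v x ^ p ≤ C ^ p * x ^ (d - 1 - α * p) := by
  have h1 := Real.rpow_le_rpow (h.pos x hx).le (hv x hRx) (by linarith : 0 ≤ p)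
  rw [Real.mul_rpow hC.le (by positivity), ← Real.rpow_mul hx.le] at h1
  calc _ ≤ x ^ (d - 1) * (C ^ p * x ^ (-α * p)) := by gcongr
    _ = C ^ p * (x ^ (d - 1) * x ^ (-α * p)) := by ring
    _ = _ := by rw [← Real.rpow_add hx]; congr 2; ring

theorem flux_le_of_mass_le {C δ r : ℝ} (hr : 0 < r)
    (hM : r ^ (d - 1) * f r ≤ C * r ^ δ) : f r ≤ C * r ^ (-(d - 1 - δ)) := by
  have : 0 < r ^ (d - 1) := by positivity
  refine le_of_mul_le_mul_left (hM.trans_eq ?_) this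
  rw [mul_left_comm, ← Real.rpow_add hr]
  congr 2; ring

/-- For a source exponent below `d` the mass grows at most like `r ^ (d - γ)`. Allowing `γ` below `α
* p` avoids the logarithm at `α * p = d`. -/
theorem powerDecay_flux_of_lt (h : IsRadialProfile d p v f) (hd : 2 < d) (hp : 1 < p) {α γ : ℝ}
    (hγα : γ ≤ α * p) (hγ : γ < d) (hv : PowerDecay v α) : PowerDecay f (γ - 1) := by
  obtain ⟨C, R, hC, hR, hv⟩ := hv
  set R' := max R 1
  have hR' : 1 ≤ R' := le_max_right _ _
  have hdγ : 0 < d - γ := by linarith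
  set K := R' ^ (d - 1) * f R'
  have hK : 0 ≤ K := mul_nonneg (by positivity) (h.flux_nonneg hd (by linarith))
  refine ⟨K + C ^ p / (d - γ), R', by positivity, by linarith, fun r hr => ?_⟩
  have hr0 : 0 < r := by linarith
  rw [show γ - 1 = d - 1 - (d - γ) by ring]
  refine flux_le_of_mass_le hr0 ?_
  have := le_of_hasDerivAt_nonneg
    (g := fun s => C ^ p / (d - γ) * s ^ (d - γ) - s ^ (d - 1) * f s) hr
    (fun x hx => ((Real.hasDerivAt_rpow_const
        (Or.inl (by linarith [hx.1] : (0:ℝ) < x).ne')).const_mul _).sub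
      (h.hasDerivAt_mass (by linarith [hx.1])))
    (fun x hx => by
      have hx1 : 1 ≤ x := hR'.trans hx.1
      have h1 := h.rpow_le_of_powerDecay hp hC (by linarith) hv
        ((le_max_left _ _).trans hx.1)
      have h2 : x ^ (d - 1 - α * p) ≤ x ^ (d - γ - 1) :=
        Real.rpow_le_rpow_of_exponent_le hx1 (by linarith)
      have e : C ^ p / (d - γ) * ((d - γ) * x ^ (d - γ - 1)) = C ^ p * x ^ (d - γ - 1) := by
        field_simp
      rw [e, sub_nonneg]
      exact h1.trans (by gcongr))
  have h3 : 1 ≤ r ^ (d - γ) := Real.one_le_rpow (by linarith) hdγ.le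
  have h4 : 0 ≤ C ^ p / (d - γ) * R' ^ (d - γ) := by positivity
  nlinarith

/-- The source is now integrable at infinity, so the mass stays bounded. -/
theorem powerDecay_flux_of_gt (h : IsRadialProfile d p v f) (hd : 2 < d) (hp : 1 < p) {α : ℝ}
    (hα : d < α * p) (hv : PowerDecay v α) : PowerDecay f (d - 1) := by
  obtain ⟨C, R, hC, hR, hv⟩ := hv
  set K := R ^ (d - 1) * f R
  have hK : 0 ≤ K := mul_nonneg (by positivity) (h.flux_nonneg hd (by linarith))
  have hdα : 0 < α * p - d := by linarith
  refine ⟨K + C ^ p / (α * p - d) * R ^ (d - α * p), R, by positivity, hR, fun r hr => ?_⟩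
  have hr0 : 0 < r := by linarith
  have := le_of_hasDerivAt_nonneg
    (g := fun s => -(C ^ p / (α * p - d)) * s ^ (d - α * p) - s ^ (d - 1) * f s) hr
    (fun x hx => ((Real.hasDerivAt_rpow_const
        (Or.inl (by linarith [hx.1] : (0:ℝ) < x).ne')).const_mul _).sub
      (h.hasDerivAt_mass (by linarith [hx.1])))
    (fun x hx => by
      have h1 := h.rpow_le_of_powerDecay hp hC (hR.trans_le hx.1) hv hx.1
      have e : -(C ^ p / (α * p - d)) * ((d - α * p) * x ^ (d - α * p - 1))
          = C ^ p * x ^ (d - 1 - α * p) := by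
        rw [show d - α * p - 1 = d - 1 - α * p by ring]; field_simp; ring
      rw [e, sub_nonneg]
      exact h1)
  rw [show d - 1 = d - 1 - 0 by ring]
  refine flux_le_of_mass_le hr0 ?_
  have h4 : 0 ≤ C ^ p / (α * p - d) * r ^ (d - α * p) := by positivity
  rw [Real.rpow_zero, mul_one]
  linarith

/-- The uses of supercriticality: the base exponent `m` lies below the finite-energy exponent, and
the Pohozaev coefficient `d - 2 - 2 * d / (p + 1)` is positive. The identity `p * m = m + 2` says
that `m` is fixed by the bootstrap. -/
theorem exponent_lt (hd : 2 < d) (hp : (d + 2) / (d - 2) < p) :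
    1 < p ∧ 2 / (p - 1) < (d - 2) / 2 ∧ p * (2 / (p - 1)) = 2 / (p - 1) + 2 ∧
      2 * (d / (p + 1)) < d - 2 := by
  have hd0 : 0 < d - 2 := by linarith
  have hp' : d + 2 < p * (d - 2) := (div_lt_iff₀ hd0).1 hp
  have h1 : 1 < p := by nlinarith
  have hp1 : 0 < p - 1 := by linarith
  have hp2 : 0 < p + 1 := by linarith
  refine ⟨h1, ?_, ?_, ?_⟩
  · rw [div_lt_div_iff₀ hp1 two_pos]; nlinarith
  · field_simp; ring
  · rw [mul_div_assoc', div_lt_iff₀ hp2]; nlinarith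

/-- Decay faster than `r ^ (-2 / (p - 1))` improves to decay of the flux like `r ^ (1 - d)`. -/
theorem powerDecay_flux (h : IsRadialProfile d p v f) (hd : 2 < d)
    (hp : (d + 2) / (d - 2) < p) {α : ℝ} (hα : 2 / (p - 1) < α) (hv : PowerDecay v α) :
    PowerDecay f (d - 1) := by
  obtain ⟨hp1, -, hm, -⟩ := exponent_lt hd hp
  set m := 2 / (p - 1)
  have hm0 : 0 < m := by have : 0 < p - 1 := by linarith
                         positivity
  have hδ : 0 < α - m := by linarith
  -- One round could multiply the gap `α - m` by `p`. The smaller factor `(1 + p) / 2 > 1` is used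
  -- so that the source exponent stays strictly below `d` even when `α * p = d`; `n` bounds the
  -- number of rounds still needed.
  have key : ∀ n : ℕ, ∀ α, m < α → d < p * (((1 + p) / 2) ^ n * (α - m)) → PowerDecay v α →
      PowerDecay f (d - 1) := by
    intro n
    induction n with
    | zero =>
      intro α hα hn hv
      rw [pow_zero, one_mul] at hn
      exact h.powerDecay_flux_of_gt hd hp1 (by nlinarith) hv
    | succ n ih =>
      intro α hα hn hv
      rcases lt_or_ge d (α * p) with hlt | hge
      · exact h.powerDecay_flux_of_gt hd hp1 hlt hv
      · have hgap : m * p + (1 + p) / 2 * (α - m) < α * p := by nlinarith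
        have h1 := h.powerDecay_flux_of_lt hd hp1 (γ := m * p + (1 + p) / 2 * (α - m))
          hgap.le (hgap.trans_le hge) hv
        have h0 : 0 < (1 + p) / 2 * (α - m) :=
          mul_pos (by linarith) (by linarith)
        have h2 := h.powerDecay_profile_of_flux hd (by nlinarith) h1
        refine ih _ (by nlinarith) ?_ h2
        have e : m * p + (1 + p) / 2 * (α - m) - 2 - m = (1 + p) / 2 * (α - m) := by
          linear_combination hm
        rw [e]
        calc d < _ := hn
          _ = _ := by ring
  obtain ⟨n, hn⟩ := pow_unbounded_of_one_lt (d / (p * (α - m))) (by linarith : 1 < (1 + p) / 2)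
  refine key n α hα ?_ hv
  rw [div_lt_iff₀ (by positivity)] at hn
  linarith

theorem powerDecay_profile (h : IsRadialProfile d p v f) (hd : 2 < d)
    (hf : PowerDecay f (d - 1)) : PowerDecay v (d - 2) :=
  h.powerDecay_profile_of_flux hd hd hf

theorem tendsto_flux (h : IsRadialProfile d p v f) (hd : 2 < d)
    (hp : (d + 2) / (d - 2) < p) : Tendsto f atTop (𝓝 0) := by
  obtain ⟨hp1, hm2, hm, -⟩ := exponent_lt hd hp
  have hm0 : 0 < 2 / (p - 1) := by have : 0 < p - 1 := by linarith
                                   positivity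
  obtain ⟨C, R, hC, hR, hf⟩ := h.powerDecay_flux_of_lt hd hp1 (γ := 2 / (p - 1) * p) le_rfl
    (by linarith) (h.powerDecay_base hd hp1)
  have hlim := (tendsto_rpow_neg_atTop (y := 2 / (p - 1) * p - 1) (by linarith)).const_mul C
  rw [mul_zero] at hlim
  refine tendsto_of_tendsto_of_tendsto_of_le_of_le' tendsto_const_nhds hlim ?_ ?_
  · filter_upwards [eventually_gt_atTop 0] with r hr using h.flux_nonneg hd hr
  · filter_upwards [eventually_ge_atTop R] with r hr using hf r hr

/-! ### Pohozaev functional and the lower bound. -/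

/-- The Pohozaev functional. -/
noncomputable def pohozaev (d p : ℝ) (v f : ℝ → ℝ) (r : ℝ) : ℝ :=
  r ^ d * energy p v f r - d / (p + 1) * (r ^ (d - 1) * f r * v r)

/-- The weight `d / (p + 1)` is the one for which all terms in `v ^ (p + 1)` cancel, leaving an
expression in `q = √(1 + f ^ 2)` alone. -/
theorem hasDerivAt_pohozaev (h : IsRadialProfile d p v f) (hp : 1 < p) {r : ℝ} (hr : 0 < r) :
    HasDerivAt (pohozaev d p v f)
      (-(r ^ (d - 1) * ((√(1 + f r ^ 2) - 1) / √(1 + f r ^ 2) *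
        (d - (1 + d / (p + 1)) * (√(1 + f r ^ 2) + 1))))) r := by
  have hv := h.pos r hr
  have h1 := ((Real.hasDerivAt_rpow_const (x := r) (p := d) (Or.inl hr.ne')).mul
    (h.hasDerivAt_energy hp hr)).sub
    (((h.hasDerivAt_mass hr).mul (h.hasDerivAt_profile r hr)).const_mul (d / (p + 1)))
  refine h1.congr_deriv ?_
  have hq : √(1 + f r ^ 2) ≠ 0 := by positivity
  have hp1 : p + 1 ≠ 0 := by linarith
  have hf := sq_sqrt_one_add_sq (f r)
  rw [energy]
  set q := √(1 + f r ^ 2)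
  have e1 : v r ^ (p + 1) = v r ^ p * v r := Real.rpow_add_one hv.ne' p
  have e2 : r ^ d = r ^ (d - 1) * r := by rw [Real.rpow_sub_one hr.ne']; field_simp
  have hf' : f r ^ 2 = q ^ 2 - 1 := by linarith
  rw [e1, e2]
  field_simp
  rw [hf']
  ring

/-- As `f → 0`, the last factor tends to `d - 2 - 2 * d / (p + 1) > 0`, while `(q - 1) / q` is
comparable to `f ^ 2 = (q - 1) * (q + 1)`. -/
theorem exists_pohozaev_deriv_le (h : IsRadialProfile d p v f) (hd : 2 < d)
    (hp : (d + 2) / (d - 2) < p) : ∃ c R : ℝ, 0 < c ∧ 0 < R ∧ ∀ r, R ≤ r →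
      r ^ (d - 1) * (c * f r ^ 2) ≤ r ^ (d - 1) * ((√(1 + f r ^ 2) - 1) / √(1 + f r ^ 2) *
        (d - (1 + d / (p + 1)) * (√(1 + f r ^ 2) + 1))) := by
  obtain ⟨hp1, -, -, ha⟩ := exponent_lt hd hp
  set a := d / (p + 1)
  have hq : Tendsto (fun r => √(1 + f r ^ 2)) atTop (𝓝 1) := by
    have := ((h.tendsto_flux hd hp).pow 2).const_add 1
    simpa using this.sqrt
  have hδ : Tendsto (fun r => d - (1 + a) * (√(1 + f r ^ 2) + 1)) atTop
      (𝓝 (d - (1 + a) * (1 + 1))) := ((hq.add_const 1).const_mul (1 + a)).const_sub d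
  set δ := (d - (1 + a) * (1 + 1)) / 2
  have hδ0 : 0 < δ := by simp only [δ]; linarith
  have h1 := hδ.eventually_const_lt (by simp only [δ] at hδ0 ⊢; linarith : δ < _)
  have h2 := hq.eventually_lt_const (one_lt_two)
  obtain ⟨R, hR⟩ := eventually_atTop.1 (h1.and h2)
  -- `δ` is half the limit of the last factor; `6` bounds `q * (q + 1)` once `q < 2`.
  refine ⟨δ / 6, max R 1, by positivity, by positivity, fun r hr => ?_⟩
  obtain ⟨h3, h4⟩ := hR r ((le_max_left _ _).trans hr)
  have hr1 : 1 ≤ r := (le_max_right _ _).trans hr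
  have hf := sq_sqrt_one_add_sq (f r)
  have hq1 := one_le_sqrt_one_add_sq (f r)
  set q := √(1 + f r ^ 2)
  have hf' : f r ^ 2 = (q - 1) * (q + 1) := by linarith
  have h5 : 0 ≤ q - 1 := by linarith
  refine mul_le_mul_of_nonneg_left ?_ (by positivity)
  calc δ / 6 * f r ^ 2 = (q - 1) * (q + 1) / 6 * δ := by rw [hf']; ring
    _ ≤ (q - 1) / q * δ := by
        refine mul_le_mul_of_nonneg_right ?_ hδ0.le
        rw [div_le_div_iff₀ (by norm_num) (by positivity)]
        nlinarith [mul_nonneg h5 (by nlinarith : 0 ≤ 6 - (q + 1) * q)]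
    _ ≤ _ := by gcongr

/-- Either the Pohozaev functional is eventually negative, or the profile has finite energy and
decays accordingly. -/
theorem pohozaev_neg_or_powerDecay (h : IsRadialProfile d p v f) (hd : 2 < d)
    (hp : (d + 2) / (d - 2) < p) :
    (∃ R, 0 < R ∧ ∀ r, R ≤ r → pohozaev d p v f r < 0) ∨ PowerDecay v ((d - 2) / 2) := by
  obtain ⟨hp1, -, -, -⟩ := exponent_lt hd hp
  obtain ⟨c, R, hc, hR, hder⟩ := h.exists_pohozaev_deriv_le hd hp
  have hanti : ∀ r s, R ≤ r → r ≤ s → pohozaev d p v f s ≤ pohozaev d p v f r := by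
    intro r s hr hrs
    have := le_of_hasDerivAt_nonneg (g := fun x => - pohozaev d p v f x) hrs
      (fun x hx => (h.hasDerivAt_pohozaev hp1 (by linarith [hx.1])).neg) (fun x hx => by
        have hx0 : 0 < x := by linarith [hx.1]
        rw [neg_neg]
        refine le_trans ?_ (hder x (hr.trans hx.1))
        positivity)
    linarith
  by_cases hneg : ∃ r, R ≤ r ∧ pohozaev d p v f r < 0
  · obtain ⟨r, hr, hneg⟩ := hneg
    exact Or.inl ⟨r, by linarith, fun s hs => (hanti r s hr hs).trans_lt hneg⟩
  · right
    push Not at hneg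
    have hP := hneg R le_rfl
    set K := pohozaev d p v f R
    have hd1 : 0 < (2 : ℝ) ^ (d - 1) := by positivity
    -- The functional stays in `[0, K]`, so its drop over `[r, 2 * r]` is at most `K`. Monotonicity
    -- of the mass bounds that drop below by a multiple of `r ^ d * f r ^ 2`. The `+ 1` only makes
    -- the constant positive.
    have key : ∀ r, R ≤ r → f r ^ 2 ≤ (K + 1) * 2 ^ (d - 1) / c * (r ^ (-(d / 2))) ^ 2 := by
      intro r hr
      have hr0 : 0 < r := by linarith
      have h1 := mul_sub_le_of_le_hasDerivAt (g := fun x => - pohozaev d p v f x)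
        (C := c / 2 ^ (d - 1) * r ^ (d - 1) * f r ^ 2) (by linarith : r ≤ 2 * r)
        (fun x hx => (h.hasDerivAt_pohozaev hp1 (by linarith [hx.1])).neg) (fun x hx => by
          have hx0 : 0 < x := by linarith [hx.1]
          rw [neg_neg]
          refine le_trans ?_ (hder x (hr.trans hx.1))
          have hM := h.mass_le hr0 hx.1
          have hfr := h.flux_nonneg hd hr0
          have hxp : 0 < x ^ (d - 1) := by positivity
          have hrp : 0 < r ^ (d - 1) := by positivity
          have hx2 : x ^ (d - 1) ≤ 2 ^ (d - 1) * r ^ (d - 1) := by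
            rw [← Real.mul_rpow two_pos.le hr0.le]
            exact Real.rpow_le_rpow hx0.le hx.2 (by linarith)
          have hsq : (r ^ (d - 1) * f r) ^ 2 ≤ (x ^ (d - 1) * f x) ^ 2 := by gcongr
          refine le_of_mul_le_mul_left ?_ hxp
          calc x ^ (d - 1) * (c / 2 ^ (d - 1) * r ^ (d - 1) * f r ^ 2)
              ≤ (2 ^ (d - 1) * r ^ (d - 1)) * (c / 2 ^ (d - 1) * r ^ (d - 1) * f r ^ 2) := by
                gcongr
            _ = c * (r ^ (d - 1) * f r) ^ 2 := by field_simp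
            _ ≤ c * (x ^ (d - 1) * f x) ^ 2 := by gcongr
            _ = _ := by ring)
      have h2 := hneg (2 * r) (by linarith)
      have h3 := hanti R r le_rfl hr
      have h4 : c / 2 ^ (d - 1) * r ^ (d - 1) * f r ^ 2 * (2 * r - r) ≤ K + 1 := by
        simp only [K]; linarith
      have e : (r ^ (-(d / 2))) ^ 2 = (r ^ d)⁻¹ := by
        rw [← Real.rpow_natCast, ← Real.rpow_mul hr0.le, ← Real.rpow_neg hr0.le]
        congr 1; push_cast; ring
      have e2 : r ^ d = r ^ (d - 1) * r := by rw [Real.rpow_sub_one hr0.ne']; field_simp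
      have hrd : 0 < r ^ d := by positivity
      rw [e, ← div_eq_mul_inv, le_div_iff₀ hrd, le_div_iff₀ hc]
      calc f r ^ 2 * r ^ d * c
          = 2 ^ (d - 1) * (c / 2 ^ (d - 1) * r ^ (d - 1) * f r ^ 2 * (2 * r - r)) := by
            rw [e2]; field_simp; ring
        _ ≤ 2 ^ (d - 1) * (K + 1) := by gcongr
        _ = _ := by ring
    have hf : PowerDecay f ((d / 2 + 1) - 1) := by
      refine ⟨√((K + 1) * 2 ^ (d - 1) / c), R, by positivity, hR, fun r hr => ?_⟩
      have hr0 : 0 < r := by linarith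
      refine le_of_sq_le_sq ?_ (by positivity)
      rw [mul_pow, Real.sq_sqrt (by positivity), add_sub_cancel_right]
      exact key r hr
    have := h.powerDecay_profile_of_flux hd (by linarith) hf
    rwa [show d / 2 + 1 - 2 = (d - 2) / 2 by ring] at this

/-- The lower bound for profiles whose Pohozaev functional is eventually negative. -/
theorem exists_le_of_pohozaev_neg (h : IsRadialProfile d p v f) (hd : 2 < d)
    (hp : (d + 2) / (d - 2) < p) {R : ℝ}
    (hneg : ∀ r, R ≤ r → pohozaev d p v f r < 0) :
    ∃ c R', 0 < c ∧ 0 < R' ∧ ∀ r, R' ≤ r →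
      c * r ^ (-(2 * d / ((d - 1) * (p + 1) - 2 * d))) ≤ v r := by
  obtain ⟨hp1, -, -, ha⟩ := exponent_lt hd hp
  obtain ⟨Q, hQ1, hQ⟩ := h.exists_sqrt_le hd hp1
  have hp2 : 0 < p + 1 := by linarith
  set a := d / (p + 1) with ha'
  have ha0 : 0 < a := by positivity
  -- `k` is chosen so that `E * v ^ (-k)` is nonincreasing, and `b` so that `-v' ≤ L * v ^ (k / 2)`
  -- integrates to a linear bound on `v ^ (-b)`.
  set k := (d - 1) / a with hk
  set b := k / 2 - 1 with hb
  have hkd : k * a = d - 1 := by rw [hk]; field_simp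
  have hb0 : 0 < b := by
    have : 2 < k := by rw [hk, lt_div_iff₀ ha0]; linarith
    simp only [hb]; linarith
  have hden : 2 * d / ((d - 1) * (p + 1) - 2 * d) = 1 / b := by
    have e : b = ((d - 1) * (p + 1) - 2 * d) / (2 * d) := by
      rw [hb, hk, ha']; field_simp
    rw [e, one_div_div]
  rw [hden]
  set R₁ := max R 1
  have hR1 : 1 ≤ R₁ := le_max_right _ _
  have hR1' : R ≤ R₁ := le_max_left _ _
  set E := energy p v f
  have hE0 : ∀ r, 0 < r → 0 ≤ E r := fun r hr =>
    le_trans (by linarith [one_le_sqrt_one_add_sq (f r)]) (h.sqrt_sub_one_le_energy hp1 hr)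
  set K := E R₁ * v R₁ ^ (-k)
  have hK : 0 ≤ K := mul_nonneg (hE0 _ (by linarith)) (Real.rpow_nonneg (h.pos _ (by linarith)).le _)
  -- Negativity of the Pohozaev functional reads `x * E < a * f * v`. Since `k * a = d - 1`, the
  -- derivative of `E * v ^ (-k)` is a nonpositive multiple of `a * f * v - x * E`.
  have hEle : ∀ r, R₁ ≤ r → E r * v r ^ (-k) ≤ K := by
    intro r hr
    have := le_of_hasDerivAt_nonneg (g := fun x => -(E x * v x ^ (-k))) hr
      (fun x hx => ((h.hasDerivAt_energy hp1 (by linarith [hx.1])).mul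
        ((h.hasDerivAt_profile x (by linarith [hx.1])).rpow_const
          (Or.inl (h.pos x (by linarith [hx.1])).ne'))).neg) (fun x hx => by
        have hx0 : 0 < x := by linarith [hx.1]
        have hv := h.pos x hx0
        have hf := h.flux_nonneg hd hx0
        have hP := hneg x (hR1'.trans hx.1)
        have hEx : x * E x ≤ a * (f x * v x) := by
          have e2 : x ^ d = x ^ (d - 1) * x := by rw [Real.rpow_sub_one hx0.ne']; field_simp
          rw [pohozaev, e2] at hP
          have : 0 < x ^ (d - 1) := by positivity
          refine le_of_mul_le_mul_left ?_ this
          calc x ^ (d - 1) * (x * E x) = x ^ (d - 1) * x * E x := by ring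
            _ ≤ a * (x ^ (d - 1) * f x * v x) := by linarith
            _ = _ := by ring
        have e3 : v x ^ (-k) = v x ^ (-k - 1) * v x := by
          rw [Real.rpow_sub_one hv.ne']; field_simp
        have hq : 0 < √(1 + f x ^ 2) := by positivity
        change 0 ≤ -(-((d - 1) * f x ^ 2 / (x * √(1 + f x ^ 2))) * v x ^ (-k) +
          E x * (-(f x / √(1 + f x ^ 2)) * -k * v x ^ (-k - 1)))
        have e4 : -(-((d - 1) * f x ^ 2 / (x * √(1 + f x ^ 2))) * v x ^ (-k) +
            E x * (-(f x / √(1 + f x ^ 2)) * -k * v x ^ (-k - 1))) =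
            v x ^ (-k - 1) * (f x / (x * √(1 + f x ^ 2))) * (k * (a * (f x * v x) - x * E x)) := by
          rw [e3, ← hkd]; field_simp; ring
        rw [e4]
        have hk0 : 0 ≤ k := by simp only [hb] at hb0; linarith
        have : 0 ≤ a * (f x * v x) - x * E x := by linarith
        positivity)
    linarith
  set L := √(K * (Q + 1)) + 1
  have hL : 0 < L := by positivity
  -- `f ^ 2 = (q - 1) * (q + 1)`, with `q - 1 ≤ E ≤ K * v ^ k` and `q ≤ Q`.
  have hfle : ∀ r, R₁ ≤ r → f r ≤ L * v r ^ (k / 2) := by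
    intro r hr
    have hr0 : 0 < r := by linarith
    have hv := h.pos r hr0
    have h1 := h.sqrt_sub_one_le_energy hp1 hr0
    have h2 := hEle r hr
    have h3 := hQ r (by linarith)
    have h4 := one_le_sqrt_one_add_sq (f r)
    have hf := sq_sqrt_one_add_sq (f r)
    rw [Real.rpow_neg hv.le, ← div_eq_mul_inv, div_le_iff₀ (by positivity)] at h2
    set q := √(1 + f r ^ 2)
    have h5 : f r ^ 2 ≤ (√(K * (Q + 1)) * v r ^ (k / 2)) ^ 2 := by
      rw [mul_pow, Real.sq_sqrt (by positivity)]
      have e : (v r ^ (k / 2)) ^ 2 = v r ^ k := by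
        rw [← Real.rpow_natCast, ← Real.rpow_mul hv.le]; congr 1; push_cast; ring
      rw [e]
      calc f r ^ 2 = (q - 1) * (q + 1) := by linarith
        _ ≤ (K * v r ^ k) * (Q + 1) := by
            gcongr
            linarith
        _ = _ := by ring
    refine (le_of_sq_le_sq h5 (by positivity)).trans ?_
    gcongr
    simp only [L]; linarith
  have hmain : ∀ r, R₁ ≤ r → v r ^ (-b) ≤ (v R₁ ^ (-b) + b * L) * r := by
    intro r hr
    have h1 := le_of_hasDerivAt_nonneg (g := fun x => b * L * x - v x ^ (-b)) hr
      (fun x hx => ((hasDerivAt_id x).const_mul (b * L)).sub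
        ((h.hasDerivAt_profile x (by linarith [hx.1])).rpow_const
          (Or.inl (h.pos x (by linarith [hx.1])).ne'))) (fun x hx => by
        have hx0 : 0 < x := by linarith [hx.1]
        have hv := h.pos x hx0
        have hf := h.flux_nonneg hd hx0
        have h2 := (le_div_sqrt_of_nonneg hf).trans (hfle x hx.1)
        have h3 : v x ^ (k / 2) * v x ^ (-b - 1) = 1 := by
          rw [← Real.rpow_add hv, hb, show k / 2 + (-(k / 2 - 1) - 1) = 0 by ring, Real.rpow_zero]
        have h4 : f x / √(1 + f x ^ 2) * v x ^ (-b - 1) ≤ L := by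
          calc _ ≤ L * v x ^ (k / 2) * v x ^ (-b - 1) := by gcongr
            _ = L := by rw [mul_assoc, h3, mul_one]
        nlinarith)
    have h5 : 0 < v R₁ ^ (-b) := Real.rpow_pos_of_pos (h.pos _ (by linarith)) _
    have h6 : 0 < b * L := by positivity
    nlinarith
  have hc : 0 < v R₁ ^ (-b) + b * L := by
    have h5 : 0 < v R₁ ^ (-b) := Real.rpow_pos_of_pos (h.pos _ (by linarith)) _
    positivity
  refine ⟨(v R₁ ^ (-b) + b * L) ^ (-(1 / b)), R₁, by positivity, by linarith, fun r hr => ?_⟩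
  have hr0 : 0 < r := by linarith
  have hv := h.pos r hr0
  have h1 := Real.rpow_le_rpow_of_nonpos (by positivity) (hmain r hr)
    (by rw [neg_nonpos]; positivity : -(1 / b) ≤ 0)
  rw [← Real.rpow_mul hv.le, Real.mul_rpow hc.le hr0.le] at h1
  rwa [show -b * -(1 / b) = 1 by field_simp, Real.rpow_one] at h1

end IsRadialProfile

/-! ### From the equation in `ℝᴺ` to the radial system. -/

theorem hasFDerivAt_norm_of_ne_zero {E : Type*} [NormedAddCommGroup E] [InnerProductSpace ℝ E]
    {x : E} (hx : x ≠ 0) : HasFDerivAt (fun y : E => ‖y‖) (‖x‖⁻¹ • innerSL ℝ x) x := by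
  have hx0 : 0 < ‖x‖ := norm_pos_iff.2 hx
  have h := (hasStrictFDerivAt_norm_sq x).hasFDerivAt.sqrt (by positivity)
  simp only [Real.sqrt_sq (norm_nonneg _)] at h
  convert h using 1
  ext y
  simp
  field_simp

section Radial

variable {N : ℕ} {p : ℝ} {u : EuclideanSpace ℝ (Fin N) → ℝ} {e : EuclideanSpace ℝ (Fin N)}

/-- The profile of a radial function along the unit vector `e`. -/
noncomputable def profile (u : EuclideanSpace ℝ (Fin N) → ℝ) (e : EuclideanSpace ℝ (Fin N))
    (r : ℝ) : ℝ := u (r • e)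

/-- The inward radial component of the flux of `u` along `e`. -/
noncomputable def radialFlux (u : EuclideanSpace ℝ (Fin N) → ℝ) (e : EuclideanSpace ℝ (Fin N))
    (r : ℝ) : ℝ := -inner ℝ (flux u (r • e)) e

/-- The radial derivative of `u` along `e`. -/
noncomputable def radialDeriv (u : EuclideanSpace ℝ (Fin N) → ℝ) (e : EuclideanSpace ℝ (Fin N))
    (r : ℝ) : ℝ := inner ℝ (∇ u (r • e)) e

theorem IsRadial.eq_profile (hrad : IsRadial u) (he : ‖e‖ = 1) (x : EuclideanSpace ℝ (Fin N)) :
    u x = profile u e ‖x‖ :=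
  hrad _ _ (by rw [norm_smul, he, norm_norm, mul_one])

theorem hasDerivAt_profile_of_differentiable (hu : Differentiable ℝ u) (r : ℝ) :
    HasDerivAt (profile u e) (radialDeriv u e r) r := by
  have h1 : HasDerivAt (fun s : ℝ => s • e) e r := by
    simpa using (hasDerivAt_id r).smul_const e
  have h2 := (hu (r • e)).hasFDerivAt.comp_hasDerivAt r h1
  rw [radialDeriv, inner_gradient_left]
  exact h2

theorem IsRadial.gradient_eq (hrad : IsRadial u) (hu : Differentiable ℝ u) (he : ‖e‖ = 1)
    {x : EuclideanSpace ℝ (Fin N)} (hx : x ≠ 0) :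
    ∇ u x = (radialDeriv u e ‖x‖ / ‖x‖) • x := by
  apply HasGradientAt.gradient
  rw [hasGradientAt_iff_hasFDerivAt]
  have h1 : u = profile u e ∘ fun x => ‖x‖ := funext fun x => hrad.eq_profile he x
  have h2 := (hasDerivAt_profile_of_differentiable (e := e) hu ‖x‖).comp_hasFDerivAt x
    (hasFDerivAt_norm_of_ne_zero hx)
  rw [← h1] at h2
  refine h2.congr_fderiv ?_
  ext y
  simp only [map_smul, smul_apply, smul_eq_mul, innerSL_apply_apply,
    InnerProductSpace.toDual_apply_apply]
  ring

theorem IsRadial.gradient_smul (hrad : IsRadial u) (hu : Differentiable ℝ u) (he : ‖e‖ = 1)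
    {r : ℝ} (hr : 0 < r) : ∇ u (r • e) = radialDeriv u e r • e := by
  have he0 : e ≠ 0 := norm_ne_zero_iff.1 (by rw [he]; exact one_ne_zero)
  rw [hrad.gradient_eq hu he (smul_ne_zero hr.ne' he0), norm_smul, he, mul_one,
    Real.norm_of_nonneg hr.le, smul_smul, div_mul_cancel₀ _ hr.ne']

theorem IsGroundState.abs_radialDeriv_lt_one (hu : IsGroundState p u) (hrad : IsRadial u)
    (he : ‖e‖ = 1) {r : ℝ} (hr : 0 < r) : |radialDeriv u e r| < 1 := by
  have := hu.norm_gradient_lt_one (r • e)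
  rwa [hrad.gradient_smul hu.differentiable he hr, norm_smul, he, mul_one] at this

theorem IsGroundState.radialFlux_eq (hu : IsGroundState p u) (hrad : IsRadial u)
    (he : ‖e‖ = 1) {r : ℝ} (hr : 0 < r) :
    radialFlux u e r = -(radialDeriv u e r / √(1 - radialDeriv u e r ^ 2)) := by
  rw [radialFlux, flux, hrad.gradient_smul hu.differentiable he hr, norm_smul, he, mul_one,
    Real.norm_eq_abs, sq_abs, inner_smul_left, inner_smul_left, real_inner_self_eq_norm_sq, he]
  simp
  ring

/-- On `(-1, 1)` the map `t ↦ t / √(1 - t ^ 2)` has inverse `s ↦ s / √(1 + s ^ 2)`. -/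
theorem IsGroundState.radialDeriv_eq (hu : IsGroundState p u) (hrad : IsRadial u)
    (he : ‖e‖ = 1) {r : ℝ} (hr : 0 < r) :
    radialDeriv u e r = -(radialFlux u e r / √(1 + radialFlux u e r ^ 2)) := by
  have h1 := hu.abs_radialDeriv_lt_one hrad he hr
  rw [hu.radialFlux_eq hrad he hr]
  set g := radialDeriv u e r
  have hg : 0 < 1 - g ^ 2 := by
    have := (sq_lt_one_iff_abs_lt_one g).2 h1
    linarith
  have h2 : 1 + (-(g / √(1 - g ^ 2))) ^ 2 = 1 / (1 - g ^ 2) := by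
    rw [neg_sq, div_pow, Real.sq_sqrt hg.le]; field_simp; ring
  rw [h2, Real.sqrt_div one_pos.le, Real.sqrt_one]
  have : 0 < √(1 - g ^ 2) := Real.sqrt_pos.2 hg
  field_simp

theorem IsGroundState.flux_eq (hu : IsGroundState p u) (hrad : IsRadial u) (he : ‖e‖ = 1)
    {x : EuclideanSpace ℝ (Fin N)} (hx : x ≠ 0) :
    flux u x = (-(radialFlux u e ‖x‖ / ‖x‖)) • x := by
  have hx0 : 0 < ‖x‖ := norm_pos_iff.2 hx
  have h1 : ‖(radialDeriv u e ‖x‖ / ‖x‖) • x‖ ^ 2 = radialDeriv u e ‖x‖ ^ 2 := by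
    rw [norm_smul, norm_div, norm_norm, div_mul_cancel₀ _ hx0.ne', Real.norm_eq_abs, sq_abs]
  rw [flux, hu.radialFlux_eq hrad he hx0, hrad.gradient_eq hu.differentiable he hx, h1, smul_smul]
  congr 1
  ring

/-- The divergence of a radial vector field `h(|x|) x`. -/
theorem divergence_radial {h : ℝ → ℝ} {h' : ℝ} {x : EuclideanSpace ℝ (Fin N)} (hx : x ≠ 0)
    (hh : HasDerivAt h h' ‖x‖) :
    divergence (fun y => h ‖y‖ • y) x = N * h ‖x‖ + h' * ‖x‖ := by
  have hx0 : 0 < ‖x‖ := norm_pos_iff.2 hx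
  have h1 := (hh.comp_hasFDerivAt x (hasFDerivAt_norm_of_ne_zero hx)).smul
    (hasFDerivAt_id (𝕜 := ℝ) x)
  have h2 : HasFDerivAt (fun y : EuclideanSpace ℝ (Fin N) => h ‖y‖ • y) _ x := h1
  rw [divergence, h2.fderiv]
  have h3 : ∀ i, (h' * (‖x‖⁻¹ * x.ofLp i)) * x.ofLp i = h' * ‖x‖⁻¹ * x.ofLp i ^ 2 := fun i => by
    ring
  simp [EuclideanSpace.inner_single_right, Finset.sum_add_distrib, h3, ← Finset.mul_sum,
    ← EuclideanSpace.real_norm_sq_eq]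
  field_simp

theorem IsGroundState.differentiable_radialFlux (hu : IsGroundState p u) :
    Differentiable ℝ (radialFlux u e) := by
  have h1 : Differentiable ℝ (fun r : ℝ => flux u (r • e)) :=
    hu.differentiable_flux.comp (differentiable_id.smul_const e)
  exact (h1.inner ℝ (differentiable_const e)).neg

/-- Away from the origin the flux field is `h(|x|) x` with `h = -f / r`, whose divergence `N * h + r
* h'` equals `-(f' + (N - 1) * f / r)`. -/
theorem IsGroundState.hasDerivAt_radialFlux (hu : IsGroundState p u) (hrad : IsRadial u)
    (he : ‖e‖ = 1) {r : ℝ} (hr : 0 < r) :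
    HasDerivAt (radialFlux u e)
      (profile u e r ^ p - ((N : ℝ) - 1) * radialFlux u e r / r) r := by
  have he0 : e ≠ 0 := norm_ne_zero_iff.1 (by rw [he]; exact one_ne_zero)
  have hx : r • e ≠ 0 := smul_ne_zero hr.ne' he0
  have hn : ‖r • e‖ = r := by rw [norm_smul, he, mul_one, Real.norm_of_nonneg hr.le]
  have h1 := (hu.differentiable_radialFlux (e := e) r).hasDerivAt
  set f' := deriv (radialFlux u e) r
  have h2 : HasDerivAt (fun s => -(radialFlux u e s / s))
      (-((f' * r - radialFlux u e r * 1) / r ^ 2)) ‖r • e‖ := by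
    rw [hn]; exact (h1.div (hasDerivAt_id r) hr.ne').neg
  have h3 := divergence_radial hx h2
  have h4 : flux u =ᶠ[𝓝 (r • e)] fun y => (-(radialFlux u e ‖y‖ / ‖y‖)) • y := by
    filter_upwards [isOpen_ne.mem_nhds hx] with y hy using hu.flux_eq hrad he hy
  have h5 : divergence (flux u) (r • e) =
      divergence (fun y => (-(radialFlux u e ‖y‖ / ‖y‖)) • y) (r • e) := by
    rw [divergence, divergence, h4.fderiv_eq]
  have h6 := hu.equation (r • e)
  rw [h5, h3, hn] at h6
  refine h1.congr_deriv ?_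
  change _ + profile u e r ^ p = 0 at h6
  field_simp at h6 ⊢
  linear_combination -h6

theorem IsGroundState.isRadialProfile (hu : IsGroundState p u) (hrad : IsRadial u)
    (he : ‖e‖ = 1) : IsRadialProfile N p (profile u e) (radialFlux u e) where
  hasDerivAt_profile r hr := by
    rw [← hu.radialDeriv_eq hrad he hr]
    exact hasDerivAt_profile_of_differentiable hu.differentiable r
  hasDerivAt_flux r hr := hu.hasDerivAt_radialFlux hrad he hr
  pos r _ := hu.pos _
  tendsto_zero := by
    refine hu.vanishes.comp ?_
    rw [← Metric.cobounded_eq_cocompact, ← tendsto_norm_atTop_iff_cobounded]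
    simp only [norm_smul, he, mul_one]
    exact tendsto_norm_atTop_atTop
  bounded := by
    obtain ⟨B, hB⟩ := (isCompact_Icc (a := (0 : ℝ)) (b := 1)).exists_bound_of_continuousOn
      (hu.differentiable_radialFlux (e := e)).continuous.continuousOn
    exact ⟨B, fun r h0 h1 => hB r ⟨h0.le, h1⟩⟩

theorem norm_flux_eq (hu : IsGroundState p u) (hrad : IsRadial u) (he : ‖e‖ = 1)
    {x : EuclideanSpace ℝ (Fin N)} (hx : x ≠ 0) : ‖flux u x‖ = |radialFlux u e ‖x‖| := by
  rw [hu.flux_eq hrad he hx, norm_smul, norm_neg, norm_div, norm_norm,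
    div_mul_cancel₀ _ (norm_ne_zero_iff.2 hx), Real.norm_eq_abs]

theorem norm_gradient_le_norm_flux (hu : IsGroundState p u) (x : EuclideanSpace ℝ (Fin N)) :
    ‖∇ u x‖ ≤ ‖flux u x‖ := by
  have h1 := hu.norm_gradient_lt_one x
  have h2 : 0 < 1 - ‖∇ u x‖ ^ 2 := by nlinarith [norm_nonneg (∇ u x)]
  rw [flux, norm_smul, Real.norm_of_nonneg (by positivity)]
  refine le_mul_of_one_le_left (norm_nonneg _) ?_
  rw [one_le_div (Real.sqrt_pos.2 h2)]
  exact Real.sqrt_le_one.2 (by nlinarith [sq_nonneg ‖∇ u x‖])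

/-- Only `u` and its flux are assumed differentiable; inverting the flux map writes the gradient as
a continuous function of the flux. -/
theorem IsGroundState.continuous_gradient (hu : IsGroundState p u) :
    Continuous (∇ u) := by
  have h : ∇ u = fun x => (1 / √(1 + ‖flux u x‖ ^ 2)) • flux u x := by
    funext x
    have h1 := hu.norm_gradient_lt_one x
    have h2 : 0 < 1 - ‖∇ u x‖ ^ 2 := by nlinarith [norm_nonneg (∇ u x)]
    have h3 : 0 < √(1 - ‖∇ u x‖ ^ 2) := Real.sqrt_pos.2 h2
    have h4 : 1 + ‖flux u x‖ ^ 2 = 1 / (1 - ‖∇ u x‖ ^ 2) := by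
      rw [flux, norm_smul, Real.norm_of_nonneg (by positivity), mul_pow, div_pow,
        Real.sq_sqrt h2.le]
      field_simp; ring
    rw [h4, Real.sqrt_div one_pos.le, Real.sqrt_one, flux, smul_smul]
    have : 1 / (1 / √(1 - ‖∇ u x‖ ^ 2)) * (1 / √(1 - ‖∇ u x‖ ^ 2)) = 1 := by field_simp
    rw [this, one_smul]
  have hc := hu.differentiable_flux.continuous
  rw [h]
  have hs : Continuous fun x => √(1 + ‖flux u x‖ ^ 2) :=
    (continuous_const.add (hc.norm.pow 2)).sqrt
  have hs0 : ∀ x, √(1 + ‖flux u x‖ ^ 2) ≠ 0 := fun x => by positivity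
  exact (continuous_const.div hs hs0).smul hc

end Radial

/-! ### Integrability, weak gradients and decay. -/

/-- Continuity handles a large ball, so `g` is dominated everywhere by a multiple of `(1 + ‖x‖) ^
(-s)`, whose `q`-th power is integrable when `s * q > N`. -/
theorem memLp_of_norm_le_rpow {N : ℕ} {F : Type*} [NormedAddCommGroup F]
    {g : EuclideanSpace ℝ (Fin N) → F} (hg : Continuous g) {C R s : ℝ} (hs : 0 < s)
    (hR : ∀ x, R ≤ ‖x‖ → ‖g x‖ ≤ C * ‖x‖ ^ (-s)) {q : ℝ} (hq : 0 < q) (hqs : (N : ℝ) < s * q) :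
    MemLp g (ENNReal.ofReal q) volume := by
  obtain ⟨B, hB⟩ := (isCompact_closedBall (0 : EuclideanSpace ℝ (Fin N)) (max R 1)
    ).exists_bound_of_continuousOn hg.continuousOn
  set K := |B| * (1 + max R 1) ^ s + |C| * 2 ^ s
  have hR1 : 1 ≤ max R 1 := le_max_right _ _
  have hle : ∀ x, ‖g x‖ ≤ K * (1 + ‖x‖) ^ (-s) := by
    intro x
    have hx := norm_nonneg x
    have h0 : 0 < (1 + ‖x‖) ^ s := by positivity
    rw [Real.rpow_neg (by positivity), ← div_eq_mul_inv, le_div_iff₀ h0]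
    rcases le_total ‖x‖ (max R 1) with h | h
    · have h1 : ‖g x‖ ≤ |B| := (hB x (by simpa using h)).trans (le_abs_self B)
      have h2 : (1 + ‖x‖) ^ s ≤ (1 + max R 1) ^ s := by gcongr
      have h3 : 0 ≤ |C| * 2 ^ s := by positivity
      calc _ ≤ |B| * (1 + max R 1) ^ s := by gcongr
        _ ≤ K := by simp only [K]; linarith
    · have hx1 : 1 ≤ ‖x‖ := hR1.trans h
      have h1 : ‖g x‖ ≤ |C| * ‖x‖ ^ (-s) := (hR x ((le_max_left _ _).trans h)).trans
        (by gcongr; exact le_abs_self C)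
      have h2 : (1 + ‖x‖) ^ s ≤ 2 ^ s * ‖x‖ ^ s := by
        rw [← Real.mul_rpow two_pos.le hx]
        exact Real.rpow_le_rpow (by positivity) (by linarith) hs.le
      have h3 : 0 ≤ |B| * (1 + max R 1) ^ s :=
        mul_nonneg (abs_nonneg B) (Real.rpow_nonneg (by linarith) s)
      have h4 : ‖x‖ ^ (-s) * ‖x‖ ^ s = 1 := by
        rw [← Real.rpow_add (by linarith), neg_add_cancel, Real.rpow_zero]
      calc ‖g x‖ * (1 + ‖x‖) ^ s ≤ |C| * ‖x‖ ^ (-s) * (2 ^ s * ‖x‖ ^ s) := by gcongr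
        _ = |C| * 2 ^ s * (‖x‖ ^ (-s) * ‖x‖ ^ s) := by ring
        _ ≤ K := by rw [h4]; simp only [K]; linarith
  have hK : 0 ≤ K := add_nonneg (mul_nonneg (abs_nonneg B) (Real.rpow_nonneg (by linarith) s))
    (by positivity)
  have hcont : Continuous fun x : EuclideanSpace ℝ (Fin N) => K * (1 + ‖x‖) ^ (-s) :=
    continuous_const.mul ((continuous_const.add continuous_norm).rpow_const
      fun x => Or.inl (by positivity : (0 : ℝ) < 1 + ‖x‖).ne')
  have hmem : MemLp (fun x : EuclideanSpace ℝ (Fin N) => K * (1 + ‖x‖) ^ (-s))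
      (ENNReal.ofReal q) volume := by
    rw [← integrable_norm_rpow_iff hcont.aestronglyMeasurable
      (by simpa using hq) ENNReal.ofReal_ne_top, ENNReal.toReal_ofReal hq.le]
    have h1 : Integrable (fun x : EuclideanSpace ℝ (Fin N) => (1 + ‖x‖) ^ (-(s * q))) volume :=
      integrable_one_add_norm (by simpa using hqs)
    refine (h1.const_mul (K ^ q)).congr (Eventually.of_forall fun x => ?_)
    have h2 : 0 < (1 + ‖x‖) := by positivity
    simp only
    rw [Real.norm_of_nonneg (by positivity), Real.mul_rpow hK (by positivity),
      ← Real.rpow_mul h2.le, neg_mul]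
  refine hmem.of_le hg.aestronglyMeasurable (Eventually.of_forall fun x => ?_)
  rw [Real.norm_of_nonneg (by positivity : 0 ≤ K * (1 + ‖x‖) ^ (-s))]
  exact hle x

theorem isWeakGradient_gradient {N : ℕ} {u : EuclideanSpace ℝ (Fin N) → ℝ}
    (hu : Differentiable ℝ u) (hg : Continuous (∇ u)) : IsWeakGradient u (∇ u) := by
  refine ⟨hu.continuous.locallyIntegrable, hg.locallyIntegrable, fun φ hφ hφc i => ?_⟩
  have hi : ∀ x, ∇ u x i = fderiv ℝ u x (EuclideanSpace.single i 1) := fun x => by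
    rw [← inner_gradient_left, EuclideanSpace.inner_single_right]; simp
  have hφ1 : Continuous fun x => fderiv ℝ φ x (EuclideanSpace.single i 1) :=
    (hφ.continuous_fderiv (by simp)).clm_apply continuous_const
  have hui : Continuous fun x => fderiv ℝ u x (EuclideanSpace.single i 1) := by
    simp_rw [← hi]
    exact (EuclideanSpace.proj i : EuclideanSpace ℝ (Fin N) →L[ℝ] ℝ).continuous.comp hg
  simp_rw [hi]
  refine integral_mul_fderiv_eq_neg_fderiv_mul_of_integrable ?_ ?_ ?_
    (fun x _ => hu x) (fun x _ => hφ.differentiable (by simp) x)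
  · exact (hui.mul hφ.continuous).integrable_of_hasCompactSupport hφc.mul_left
  · exact (hu.continuous.mul hφ1).integrable_of_hasCompactSupport
      ((hφc.fderiv_apply (𝕜 := ℝ) _).mul_left)
  · exact (hu.continuous.mul hφ.continuous).integrable_of_hasCompactSupport hφc.mul_left

/-- Radially nonincreasing functions in `L^q` decay like `|x| ^ (-N / q)`. -/
theorem powerDecay_of_memLp {N : ℕ} (hN : 0 < N) {u : EuclideanSpace ℝ (Fin N) → ℝ} {v : ℝ → ℝ}
    (huv : ∀ x, u x = v ‖x‖) (hpos : ∀ x, 0 < u x)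
    (hanti : ∀ r s, 0 < r → r ≤ s → v s ≤ v r) {q : ℝ} (hq : 0 < q)
    (hu : MemLp u (ENNReal.ofReal q) volume) : PowerDecay v ((N : ℝ) / q) := by
  have : NeZero N := ⟨hN.ne'⟩
  set I := (eLpNorm u (ENNReal.ofReal q) volume ^ q).toReal
  have hIfin : eLpNorm u (ENNReal.ofReal q) volume ^ q ≠ ⊤ :=
    ENNReal.rpow_ne_top_of_nonneg hq.le hu.2.ne
  set b := (volume (Metric.ball (0 : EuclideanSpace ℝ (Fin N)) 1)).toReal
  have hb : 0 < b := ENNReal.toReal_pos (Metric.measure_ball_pos _ _ one_pos).ne'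
    measure_ball_lt_top.ne
  refine ⟨((I + 1) / b) ^ (1 / q), 1, by positivity, one_pos, fun r hr => ?_⟩
  have hr0 : 0 < r := by linarith
  have hv : 0 < v r := by
    have := hpos (EuclideanSpace.single ⟨0, hN⟩ r)
    rwa [huv, PiLp.norm_single, Real.norm_of_nonneg hr0.le] at this
  -- Chebyshev's inequality at level `v r ^ q`: the superlevel set contains the ball of radius `r`
  -- minus its centre, where monotonicity says nothing, so `v r ^ q * r ^ N` is bounded.
  have h1 := mul_meas_ge_le_pow_eLpNorm volume (by simpa using hq : ENNReal.ofReal q ≠ 0)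
    ENNReal.ofReal_ne_top hu.1 (ENNReal.ofReal (v r ^ q))
  rw [ENNReal.toReal_ofReal hq.le] at h1
  have hsub : Metric.ball (0 : EuclideanSpace ℝ (Fin N)) r \ {0} ⊆
      {x | ENNReal.ofReal (v r ^ q) ≤ ‖u x‖ₑ ^ q} := by
    rintro x ⟨hx, hx0⟩
    have hx1 : ‖x‖ < r := by simpa using hx
    have hx2 : 0 < ‖x‖ := norm_pos_iff.2 hx0
    have h2 := hanti ‖x‖ r hx2 hx1.le
    rw [← huv] at h2
    rw [Set.mem_ofPred_eq, ← ofReal_norm, Real.norm_of_nonneg (hpos x).le,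
      ENNReal.ofReal_rpow_of_pos (hpos x)]
    exact ENNReal.ofReal_le_ofReal (Real.rpow_le_rpow hv.le h2 hq.le)
  have h3 : volume (Metric.ball (0 : EuclideanSpace ℝ (Fin N)) r) ≤
      volume {x | ENNReal.ofReal (v r ^ q) ≤ ‖u x‖ₑ ^ q} := by
    rw [← measure_sdiff_null (measure_singleton (0 : EuclideanSpace ℝ (Fin N)))]
    exact measure_mono hsub
  rw [Measure.addHaar_ball volume _ hr0.le, finrank_euclideanSpace_fin] at h3
  have h4 := ENNReal.toReal_mono hIfin ((mul_le_mul_right h3 _).trans h1)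
  rw [ENNReal.toReal_mul, ENNReal.toReal_mul, ENNReal.toReal_ofReal (by positivity),
    ENNReal.toReal_ofReal (by positivity)] at h4
  change v r ^ q * (r ^ N * b) ≤ I at h4
  have h5 : v r ^ q ≤ (I + 1) / b * (r ^ N)⁻¹ := by
    rw [← div_eq_mul_inv, le_div_iff₀ (by positivity), le_div_iff₀ hb]
    linarith
  have h6 := Real.rpow_le_rpow (by positivity) h5 (by positivity : 0 ≤ 1 / q)
  rw [← Real.rpow_mul hv.le, mul_one_div_cancel hq.ne', Real.rpow_one,
    Real.mul_rpow (by positivity) (by positivity)] at h6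
  refine h6.trans_eq ?_
  congr 1
  rw [← Real.rpow_natCast, ← Real.rpow_neg hr0.le, ← Real.rpow_mul hr0.le]
  congr 1; ring

end LorentzMinkowski

/-! ### The dichotomy. -/

open LorentzMinkowski in
theorem theorem3 (N : ℕ) (hN : 3 ≤ N) (p : ℝ) (hp : ((N : ℝ) + 2) / ((N : ℝ) - 2) < p)
    (u : EuclideanSpace ℝ (Fin N) → ℝ)
    (hu : LorentzMinkowski.IsGroundState p u) (hrad : LorentzMinkowski.IsRadial u) :
    (LorentzMinkowski.MemD12 u ∧
      u =O[cocompact (EuclideanSpace ℝ (Fin N))] fun x => 1 / ‖x‖ ^ ((N : ℝ) - 2)) ∨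
    (¬ LorentzMinkowski.MemD12 u ∧
      (∃ c₁ : ℝ, 0 < c₁ ∧ ∃ c₂ : ℝ, 0 < c₂ ∧
        ∀ᶠ x in cocompact (EuclideanSpace ℝ (Fin N)),
          c₁ / ‖x‖ ^ (2 * (N : ℝ) / (((N : ℝ) - 1) * (p + 1) - 2 * (N : ℝ))) ≤ u x ∧
          u x ≤ c₂ / ‖x‖ ^ (2 / (p - 1))) ∧
      ¬ ∃ α : ℝ, 2 / (p - 1) < α ∧ ∃ c : ℝ, 0 < c ∧
        ∀ᶠ x in cocompact (EuclideanSpace ℝ (Fin N)), u x ≤ c / ‖x‖ ^ α) := by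
  have hd : (2 : ℝ) < N := by exact_mod_cast hN
  have hd2 : (0 : ℝ) < (N : ℝ) - 2 := by linarith
  obtain ⟨hp1, hm, -, -⟩ := IsRadialProfile.exponent_lt hd hp
  set e : EuclideanSpace ℝ (Fin N) := EuclideanSpace.single ⟨0, by omega⟩ 1 with he'
  have he : ‖e‖ = 1 := by rw [he', PiLp.norm_single, norm_one]
  have h := hu.isRadialProfile hrad he
  have huv := hrad.eq_profile he
  set v := profile u e
  set f := radialFlux u e
  have hnorm : Tendsto (fun x : EuclideanSpace ℝ (Fin N) => ‖x‖)
      (cocompact (EuclideanSpace ℝ (Fin N))) atTop := tendsto_norm_cocompact_atTop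
  have hdiv : ∀ (c s : ℝ) (x : EuclideanSpace ℝ (Fin N)), c / ‖x‖ ^ s = c * ‖x‖ ^ (-s) :=
    fun c s x => by rw [Real.rpow_neg (norm_nonneg x), div_eq_mul_inv]
  -- Splitting on improved decay rather than on membership in `D^{1,2}` makes the nonexistence of a
  -- better exponent in the second alternative nearly immediate.
  by_cases hA : ∃ α, 2 / (p - 1) < α ∧ PowerDecay v α
  · obtain ⟨α, hα, hv⟩ := hA
    have hf := h.powerDecay_flux hd hp hα hv
    obtain ⟨C, R, hC, hR, hvC⟩ := h.powerDecay_profile hd hf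
    obtain ⟨D, S, hD, hS, hfD⟩ := hf
    have hunorm : ∀ x, R ≤ ‖x‖ → ‖u x‖ ≤ C * ‖x‖ ^ (-((N : ℝ) - 2)) := fun x hx => by
      rw [Real.norm_of_nonneg (hu.pos x).le, huv]
      exact hvC _ hx
    refine Or.inl ⟨⟨?_, ∇ u, isWeakGradient_gradient hu.differentiable hu.continuous_gradient, ?_⟩,
      ?_⟩
    · refine memLp_of_norm_le_rpow hu.differentiable.continuous hd2 hunorm (by positivity) ?_
      rw [mul_div_cancel₀ _ hd2.ne']; linarith
    · suffices MemLp (∇ u) (ENNReal.ofReal 2) volume by simpa using this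
      refine memLp_of_norm_le_rpow hu.continuous_gradient (by linarith : 0 < (N : ℝ) - 1)
        (C := D) (R := S) (fun x hx => ?_) two_pos (by linarith)
      have hx0 : 0 < ‖x‖ := by linarith
      refine (norm_gradient_le_norm_flux hu x).trans ?_
      rw [norm_flux_eq hu hrad he (norm_pos_iff.1 hx0), abs_of_nonneg (h.flux_nonneg hd hx0)]
      exact hfD _ hx
    · refine IsBigO.of_bound C ?_
      filter_upwards [hnorm.eventually_ge_atTop R] with x hx
      rw [hdiv, one_mul, Real.norm_of_nonneg (Real.rpow_nonneg (norm_nonneg x) _)]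
      exact hunorm x hx
  · refine Or.inr ⟨fun hmem => hA ?_, ?_, ?_⟩
    -- Only the `L^{2*}` half of membership is needed: it gives the exponent `N / 2* = (N - 2) / 2`,
    -- already larger than `2 / (p - 1)`.
    · refine ⟨_, hm, ?_⟩
      have := powerDecay_of_memLp (by omega) huv hu.pos (fun r s hr hrs => h.antitone hd hr hrs)
        (by positivity) hmem.1
      rwa [show (N : ℝ) / (2 * N / (N - 2)) = (N - 2) / 2 by field_simp] at this
    · obtain ⟨R, -, hneg⟩ := (h.pohozaev_neg_or_powerDecay hd hp).resolve_right
        fun hv => hA ⟨_, hm, hv⟩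
      obtain ⟨c₁, R₁, hc₁, -, hlow⟩ := h.exists_le_of_pohozaev_neg hd hp hneg
      obtain ⟨c₂, R₂, hc₂, -, hup⟩ := h.powerDecay_base hd hp1
      refine ⟨c₁, hc₁, c₂, hc₂, ?_⟩
      filter_upwards [hnorm.eventually_ge_atTop R₁, hnorm.eventually_ge_atTop R₂] with x hx1 hx2
      rw [hdiv, hdiv, huv]
      exact ⟨hlow _ hx1, hup _ hx2⟩
    · rintro ⟨α, hα, c, hc, hev⟩
      refine hA ⟨α, hα, c, ?_⟩
      rw [← Metric.cobounded_eq_cocompact, ← comap_norm_atTop, eventually_comap,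
        eventually_atTop] at hev
      obtain ⟨R, hR⟩ := hev
      refine ⟨max R 1, hc, by positivity, fun r hr => ?_⟩
      have hr0 : 0 < r := by linarith [le_max_right R 1]
      have hn : ‖r • e‖ = r := by rw [norm_smul, he, mul_one, Real.norm_of_nonneg hr0.le]
      have := hR r ((le_max_left _ _).trans hr) (r • e) hn
      rwa [hdiv, hn] at this
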